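/- Let $K$ be a field with $\mathrm{char}\,K\neq 2$ and algebraic closure $\overline K$, and let $\mathcal C$ be the hyperelliptic curve with affine equation $y^2=f(x)$, where $f\in K[x]$ is monic of degree $2g+1$, $g\ge 1$, without multiple roots in $\overline K$. Let $O$ be the point at infinity, $\iota:(x,y)\mapsto(x,-y)$ the hyperelliptic involution, $\overline K[\mathcal C]=\overline K[x,y]/\langle y^2-f\rangle$ the coordinate ring, and $[q]$ the class of $q\in\overline K[x,y]$ in it. Divisors are divisors on $\mathcal C$ over $\overline K$. An effective divisor $\mathfrak d=\sum_P e_PP$ with $e_O=0$ is called semi-reduced if $e_P\le 1$ whenever $\iota P=P$, and $e_{\iota P}=0$ whenever $\iota P\ne P$ and $e_P>0$. For a semi-reduced divisor $\mathfrak d$: (1) $\mathrm r(\mathfrak d)$ denotes the unique semi-reduced divisor of degree at most $g$ such that $\mathfrak d-(\deg\mathfrak d)O\sim \mathrm r(\mathfrak d)-(\deg \mathrm r(\mathfrak d))O$. (2) $I(\mathfrak d)\subset\overline K[\mathcal C]$ is the ideal of all $[q]$ with $\mathrm{ord}_P([q])\ge e_P$ for all $P\in\mathrm{Supp}(\mathfrak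 d)$, and $\widetilde{I(\mathfrak d)}=\{q\in\overline K[x,y] : [q]\in I(\mathfrak d)\}$. (3) The Mumford representation of $\mathfrak d$ is the pair $(u,v)$ of polynomials in $\overline K[x]$ with $u=\prod_P(x-x_P)^{e_P}$, $\deg v<\deg u$, $\mathrm{ord}_P([y-v])\ge e_P$ for all $P\in\mathrm{Supp}(\mathfrak d)$, and $u\mid v^2-f$ (for $\mathfrak d=0$ it is $(1,0)$). (4) A Leitenberger function of $\mathfrak d$ is a polynomial $b_{\mathfrak d}=b_0+b_1y$ with $b_0,b_1\in\overline K[x]$ and $\mathrm{div}([b_{\mathfrak d}])=\mathfrak d+\iota^*\mathrm r(\mathfrak d)-(\deg\mathfrak d+\deg\mathrm r(\mathfrak d))O$; it is unique up to a nonzero constant factor. Proposition. Let $\mathfrak d$ be a semi-reduced divisor such that $\mathfrak d+\iota^*\mathrm r(\mathfrak d)$ is semi-reduced. Let $(u,v)$ be the Mumford representation of $\mathfrak d$ and let $b_{\mathfrak d}$ be a Leitenberger function of $\mathfrak d$. Then $$\widetilde{I(\mathfrak d)}=\langle u,\ b_{\mathfrak d},\ y^2-f\rangle\subset\overline K[x,y].$$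 In particular, $I(\mathfrak d)=\langle [u],[b_{\mathfrak d}]\rangle$ in $\overline K[\mathcal C]$. -/

import Mathlib

open Polynomial
open scoped Polynomial.Bivariate

noncomputable section

/-! Affine plane curves `y² = h(x)` over a field: coordinate ring, points, local rings, orders.
Bivariate polynomials `k[x, y]` are `k[X][Y]`, so `C p` is the polynomial `p(x)`. -/

namespace DoubleCover

variable {k : Type*} [Field k]

/-- The polynomial `y² - h(x)`. -/
def equation (h : k[X]) : k[X][Y] := Y ^ 2 - C h

/-- The coordinate ring `k[x, y] / ⟨y² - h⟩`. -/
abbrev CoordRing (h : k[X]) : Type _ := AdjoinRoot (equation h)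

/-- The class `[q]` in the coordinate ring of a polynomial `q` in `k[x, y]`. -/
abbrev cls (h : k[X]) : k[X][Y] →+* CoordRing h := AdjoinRoot.mk (equation h)

/-- The `k`-points of the affine curve `y² = h(x)`. -/
@[ext]
structure Point (h : k[X]) where
  x : k
  y : k
  eq : y ^ 2 = h.eval x

variable {h : k[X]}

/-- The involution `(x, y) ↦ (x, -y)`. -/
def Point.invol (P : Point h) : Point h := ⟨P.x, -P.y, by rw [neg_sq, P.eq]⟩

/-- Evaluation of polynomial functions at a point. -/
def evalAt (P : Point h) : CoordRing h →+* k :=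
  AdjoinRoot.lift (evalRingHom P.x) P.y (by simp [equation, P.eq])

/-- The maximal ideal of the coordinate ring at a point. -/
def idealAt (P : Point h) : Ideal (CoordRing h) := RingHom.ker (evalAt P)

instance (P : Point h) : (idealAt P).IsPrime := RingHom.ker_isPrime _

/-- The local ring of the curve at a point. -/
abbrev LocalRing (P : Point h) : Type _ := Localization.AtPrime (idealAt P)

/-- The order at `P` of a polynomial function: the supremum of all `n` such that its germ lies in
the `n`-th power of the maximal ideal of the local ring at `P`. At a nonsingular point, where the
local ring is a discrete valuation ring, this is the normalized valuation (with value `⊤` at `0`). -/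
def ord (P : Point h) (φ : CoordRing h) : ℕ∞ :=
  ⨆ (n : ℕ) (_ : algebraMap (CoordRing h) (LocalRing P) φ ∈
    IsLocalRing.maximalIdeal (LocalRing P) ^ n), (n : ℕ∞)

theorem le_ord_iff (P : Point h) (φ : CoordRing h) (n : ℕ) :
    (n : ℕ∞) ≤ ord P φ ↔ algebraMap (CoordRing h) (LocalRing P) φ ∈
      IsLocalRing.maximalIdeal (LocalRing P) ^ n := by
  constructor
  · intro hn
    by_contra hcon
    have hlt : ord P φ ≤ ((n - 1 : ℕ) : ℕ∞) := by
      refine iSup₂_le fun m hm => ?_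
      have : m < n := by
        by_contra hmn
        exact hcon (Ideal.pow_le_pow_right (not_lt.mp hmn) hm)
      exact_mod_cast Nat.le_sub_one_of_lt this
    have h2 : n ≤ n - 1 := by exact_mod_cast hn.trans hlt
    have h0 : n = 0 := by omega
    subst h0
    simp at hcon
  · intro hm
    exact le_iSup₂_of_le n hm le_rfl

end DoubleCover

/-- A hyperelliptic curve over `K`, `char K ≠ 2`, with affine equation `y² = f(x)`, where `f` is
monic of degree `2g + 1`, `g ≥ 1`, and has no multiple roots in the algebraic closure of `K`. -/
structure HyperellipticCurve (K : Type*) [Field K] where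
  f : K[X]
  g : ℕ
  one_le_g : 1 ≤ g
  char_ne_two : ringChar K ≠ 2
  monic : f.Monic
  natDegree_eq : f.natDegree = 2 * g + 1
  nodup_roots : (f.map (algebraMap K (AlgebraicClosure K))).roots.Nodup

namespace HyperellipticCurve

variable {K : Type*} [Field K] (𝒞 : HyperellipticCurve K)

/-- The polynomial `f` over the algebraic closure. -/
def fbar : (AlgebraicClosure K)[X] := 𝒞.f.map (algebraMap K (AlgebraicClosure K))

/-- The coordinate ring of the affine part of the curve over the algebraic closure. -/
abbrev CoordRing : Type _ := DoubleCover.CoordRing 𝒞.fbar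

/-- The class `[q]` of a polynomial `q`. -/
abbrev cls : (AlgebraicClosure K)[X][Y] →+* 𝒞.CoordRing := DoubleCover.cls 𝒞.fbar

/-- The points of the affine part, over the algebraic closure. -/
abbrev AffPoint : Type _ := DoubleCover.Point 𝒞.fbar

/-- The points of the curve over the algebraic closure: the affine points and the point at
infinity `O`, which is `none`. -/
abbrev Point : Type _ := Option 𝒞.AffPoint

/-- The hyperelliptic involution; it fixes `O`. -/
def ι : 𝒞.Point → 𝒞.Point := Option.map DoubleCover.Point.invol

/-- The equation `w² = z * (1 + c₁ z + ⋯ ) = z ^ (2g + 2) * f (1 / z)` of the curve near infinity, in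
the coordinates `z = 1 / x`, `w = y / x ^ (g + 1)`. -/
def finf : (AlgebraicClosure K)[X] := X * 𝒞.fbar.reverse

/-- The point `O` in the chart at infinity: `z = w = 0`. -/
def pointO : DoubleCover.Point 𝒞.finf := ⟨0, 0, by simp [finf]⟩

/-- The integer `n` is the order at `O` of the polynomial function `[b₀ + b₁ y]`. With
`N = max (deg b₀) (deg b₁ + g + 1)`, in the chart at infinity this function is
`z ^ (-N) * (z ^ N * b₀ (1 / z) + z ^ (N - (g + 1)) * b₁ (1 / z) * w)`, and the second factor is a
polynomial in `z` and `w`. (If the function is zero there is no such integer.) -/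
def HasOrdO (b₀ b₁ : (AlgebraicClosure K)[X]) (n : ℤ) : Prop :=
  let N := max b₀.natDegree (b₁.natDegree + (𝒞.g + 1))
  ∃ s t : ℕ,
    DoubleCover.ord 𝒞.pointO (DoubleCover.cls 𝒞.finf
      (C (b₀.reflect N) + C (b₁.reflect (N - (𝒞.g + 1))) * Y)) = s ∧
    DoubleCover.ord 𝒞.pointO (DoubleCover.cls 𝒞.finf (C X)) = t ∧
    n = (s : ℤ) - N * t

/-- Divisors on the curve (over the algebraic closure). -/
abbrev Divisor : Type _ := 𝒞.Point →₀ ℤ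

variable {𝒞}

/-- `D` is the divisor of the polynomial function `[b₀ + b₁ y]`, which then is not zero. -/
def IsDivOf (D : 𝒞.Divisor) (b₀ b₁ : (AlgebraicClosure K)[X]) : Prop :=
  (∀ P : 𝒞.AffPoint, ∃ n : ℕ,
    DoubleCover.ord P (𝒞.cls (C b₀ + C b₁ * Y)) = n ∧ D (some P) = n) ∧
  𝒞.HasOrdO b₀ b₁ (D none)

/-- Linear equivalence: `D - D'` is the divisor of a nonzero rational function, that is, of a
quotient `[a₀ + a₁ y] / [b₀ + b₁ y]` of nonzero elements of the coordinate ring. -/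
def LinEquiv (D D' : 𝒞.Divisor) : Prop :=
  ∃ (a₀ a₁ b₀ b₁ : (AlgebraicClosure K)[X]) (A B : 𝒞.Divisor),
    IsDivOf A a₀ a₁ ∧ IsDivOf B b₀ b₁ ∧ D - D' = A - B

/-- The degree of a divisor. -/
def deg (D : 𝒞.Divisor) : ℤ := D.sum fun _ n => n

/-- The divisor `n O`. -/
def multO (n : ℤ) : 𝒞.Divisor := Finsupp.single none n

/-- The divisor `ι^* D` (`ι` is an involution, so this is also the image of `D` under `ι`). -/
def pullback (D : 𝒞.Divisor) : 𝒞.Divisor := D.mapDomain 𝒞.ι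

/-- Semi-reduced divisors: effective affine divisors that contain no `P + ι P`. -/
structure IsSemiReduced (D : 𝒞.Divisor) : Prop where
  affine : D none = 0
  effective : ∀ P, 0 ≤ D P
  fixed : ∀ P, 𝒞.ι P = P → D P ≤ 1
  not_fixed : ∀ P, 𝒞.ι P ≠ P → 0 < D P → D (𝒞.ι P) = 0

/-- `r` is the `h`-reduced divisor `r(d)` attached to `d`: it is semi-reduced of degree at most `g`
and `d - (deg d) O ∼ r - (deg r) O`. -/
structure IsReductionOf (r d : 𝒞.Divisor) : Prop where
  semiReduced : IsSemiReduced r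
  deg_le : deg r ≤ 𝒞.g
  linEquiv : LinEquiv (d - multO (deg d)) (r - multO (deg r))

/-- The ideal `I(d)` of the coordinate ring: the functions with `ord_P ≥ d_P` at all affine points
of the support of `d`. -/
def idealOf (d : 𝒞.Divisor) : Ideal 𝒞.CoordRing where
  carrier := {φ | ∀ P : 𝒞.AffPoint, some P ∈ d.support →
    ((d (some P)).toNat : ℕ∞) ≤ DoubleCover.ord P φ}
  add_mem' := by
    intro a b ha hb P hP
    have h1 := ha P hP
    have h2 := hb P hP
    rw [DoubleCover.le_ord_iff] at h1 h2 ⊢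
    rw [map_add]
    exact Ideal.add_mem _ h1 h2
  zero_mem' := by
    intro P _
    rw [DoubleCover.le_ord_iff, map_zero]
    exact Ideal.zero_mem _
  smul_mem' := by
    intro c a ha P hP
    have h1 := ha P hP
    rw [DoubleCover.le_ord_iff] at h1 ⊢
    rw [smul_eq_mul, map_mul]
    exact Ideal.mul_mem_left _ _ h1

/-- The ideal of all polynomials in `x` and `y` whose class lies in `I(d)`. -/
def polyIdealOf (d : 𝒞.Divisor) : Ideal (AlgebraicClosure K)[X][Y] := (idealOf d).comap 𝒞.cls

/-- The polynomial `∏ (x - x_P) ^ d_P`, over the affine points `P` of the support of `d`. -/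
def xPoly (d : 𝒞.Divisor) : (AlgebraicClosure K)[X] :=
  d.prod fun P n => P.elim 1 fun Q => (X - C Q.x) ^ n.toNat

/-- `(u, v)` is the Mumford representation of the semi-reduced divisor `d`. As the zero polynomial
has degree `⊥`, it is `(1, 0)` for `d = 0`. -/
structure IsMumfordRep (d : 𝒞.Divisor) (u v : (AlgebraicClosure K)[X]) : Prop where
  u_eq : u = xPoly d
  degree_lt : v.degree < u.degree
  le_ord : ∀ P : 𝒞.AffPoint, some P ∈ d.support →
    ((d (some P)).toNat : ℕ∞) ≤ DoubleCover.ord P (𝒞.cls (Y - C v))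
  dvd : u ∣ v ^ 2 - 𝒞.fbar

/-- `b₀ + b₁ y` is a Leitenberger function of `d`, where `r = r(d)`: its divisor is
`d + ι^* r - (deg d + deg r) O`. It is unique up to a nonzero constant factor. -/
def IsLeitenbergerFunction (d r : 𝒞.Divisor) (b₀ b₁ : (AlgebraicClosure K)[X]) : Prop :=
  IsDivOf (d + pullback r - multO (deg d + deg r)) b₀ b₁

end HyperellipticCurve

end

/-! ### Points and maximal ideals of the coordinate ring -/

namespace DoubleCover

variable {k : Type*} [Field k] {h : k[X]}

/-! Equality of ideals is local, and by the Nullstellensatz the maximal ideals are those of affine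
points `P`, so `idealOf_eq_span` compares germs, with `b` the Leitenberger function and `ι` the
involution. If `P` is in the support of `d` and `y_P ≠ 0`, then `x - x_P` is a uniformizer and `u`
is its `d_P`-th power times a unit. If `P` is in the support and `y_P = 0`, then `u` vanishes to
order two, but semi-reducedness of `d + ι^* r` forces `ord_P b = 1 = d_P`. If only `ι P` is in the
support, semi-reducedness makes `b` a unit at `P`; if neither is, `u` is a unit. The polynomial
ideal is the preimage, which adds the kernel generator `y² - f`. -/

theorem evalAt_cls (P : Point h) (q : k[X][Y]) :
    evalAt P (cls h q) = (q.eval (C P.y)).eval P.x := by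
  have : (evalAt P).comp (cls h) = (evalRingHom P.x).comp (evalRingHom (C P.y)) := by
    refine Polynomial.ringHom_ext (fun a => ?_) ?_ <;> simp [evalAt]
  exact RingHom.congr_fun this q

theorem cls_mem_idealAt_iff (P : Point h) (q : k[X][Y]) :
    cls h q ∈ idealAt P ↔ (q.eval (C P.y)).eval P.x = 0 := by
  rw [idealAt, RingHom.mem_ker, evalAt_cls]

/-- Divide twice: `q - q(x, y_P)` by `y - y_P`, then `q(x, y_P)` by `x - x_P`. -/
theorem idealAt_eq_span (P : Point h) :
    idealAt P = Ideal.span {cls h (C (X - C P.x)), cls h (Y - C (C P.y))} := by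
  apply le_antisymm
  · intro φ hφ
    obtain ⟨q, rfl⟩ := AdjoinRoot.mk_surjective φ
    rw [cls_mem_idealAt_iff] at hφ
    obtain ⟨s, hs⟩ := X_sub_C_dvd_sub_C_eval (p := q) (a := C P.y)
    obtain ⟨t, ht⟩ := dvd_iff_isRoot.mpr hφ
    rw [Ideal.mem_span_pair]
    refine ⟨cls h (C t), cls h s, ?_⟩
    rw [← map_mul, ← map_mul C, ← map_mul (cls h), ← map_add (cls h), mul_comm t, ← ht,
      mul_comm s, ← hs, add_sub_cancel]
  · rw [Ideal.span_le]
    rintro _ (rfl | rfl) <;> rw [SetLike.mem_coe, cls_mem_idealAt_iff] <;> simp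

/-- Nullstellensatz: the residue field is finite over `k`, hence equal to `k`, and the residues of
`x` and `y` are the coordinates of the point. -/
theorem exists_idealAt_eq [IsAlgClosed k] (M : Ideal (CoordRing h)) [M.IsMaximal] :
    ∃ P : Point h, M = idealAt P := by
  let _ : Field (CoordRing h ⧸ M) := Ideal.Quotient.field M
  have : Module.Finite k (CoordRing h ⧸ M) := finite_of_finite_type_of_isJacobsonRing _ _
  have hb := IsAlgClosed.algebraMap_bijective_of_isIntegral (k := k) (K := CoordRing h ⧸ M)
  obtain ⟨x, hx⟩ := hb.2 (Ideal.Quotient.mk M (cls h (C X)))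
  obtain ⟨y, hy⟩ := hb.2 (Ideal.Quotient.mk M (cls h Y))
  let θ : k[X][Y] →+* k := (evalRingHom x).comp (evalRingHom (C y))
  have key : (algebraMap k (CoordRing h ⧸ M)).comp θ = (Ideal.Quotient.mk M).comp (cls h) := by
    refine Polynomial.ringHom_ext' (Polynomial.ringHom_ext (fun a => ?_) ?_) ?_
    · simp only [θ, RingHom.comp_apply, coe_evalRingHom, eval_C]
      rfl
    · simpa [θ] using hx
    · simpa [θ] using hy
  have hP : y ^ 2 = h.eval x := by
    have h1 := RingHom.congr_fun key (equation h)
    rw [RingHom.comp_apply, RingHom.comp_apply (Ideal.Quotient.mk M), AdjoinRoot.mk_self, map_zero,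
      map_eq_zero_iff _ hb.1] at h1
    simpa [θ, equation, sub_eq_zero] using h1
  refine ⟨⟨x, y, hP⟩, ?_⟩
  ext φ
  obtain ⟨q, rfl⟩ := AdjoinRoot.mk_surjective φ
  rw [cls_mem_idealAt_iff, ← Ideal.Quotient.eq_zero_iff_mem]
  have h1 := RingHom.congr_fun key q
  rw [RingHom.comp_apply, RingHom.comp_apply (Ideal.Quotient.mk M)] at h1
  rw [← h1, map_eq_zero_iff _ hb.1]
  rfl

theorem le_of_forall_point [IsAlgClosed k] {I J : Ideal (CoordRing h)}
    (H : ∀ P : Point h, I.map (algebraMap _ (LocalRing P)) ≤ J.map (algebraMap _ (LocalRing P))) :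
    I ≤ J := by
  refine Ideal.le_of_localization_maximal fun M hM => ?_
  obtain ⟨P, rfl⟩ := exists_idealAt_eq M
  exact H P

/-! ### Units and uniformizers in the local rings -/

theorem isUnit_germ_iff (P : Point h) (q : k[X][Y]) :
    IsUnit (algebraMap (CoordRing h) (LocalRing P) (cls h q)) ↔
      (q.eval (C P.y)).eval P.x ≠ 0 := by
  rw [IsLocalization.AtPrime.isUnit_to_map_iff (LocalRing P) (idealAt P), Ne,
    ← cls_mem_idealAt_iff]
  rfl

theorem maximalIdeal_eq_span (P : Point h) :
    IsLocalRing.maximalIdeal (LocalRing P) =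
      Ideal.span {algebraMap _ (LocalRing P) (cls h (C (X - C P.x))),
        algebraMap _ (LocalRing P) (cls h (Y - C (C P.y)))} := by
  rw [← IsLocalization.AtPrime.map_eq_maximalIdeal (idealAt P) (LocalRing P), ← Set.image_pair,
    ← Ideal.map_span]
  exact congrArg _ (idealAt_eq_span P)

/-- On the curve `y² - y_P² = h(x) - h(x_P)`, which `x - x_P` divides. Whichever cofactor is a unit
at `P` decides the uniformizer. -/
theorem exists_curve_factorization (P : Point h) :
    ∃ g : k[X], h = C (P.y ^ 2) + (X - C P.x) * g ∧
      cls h ((Y - C (C P.y)) * (Y + C (C P.y))) = cls h (C (X - C P.x) * C g) := by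
  obtain ⟨g, hg⟩ := X_sub_C_dvd_sub_C_eval (p := h) (a := P.x)
  rw [← P.eq] at hg
  refine ⟨g, by rw [← hg]; ring, ?_⟩
  rw [AdjoinRoot.mk_eq_mk]
  refine ⟨1, ?_⟩
  rw [← C_mul, ← hg, equation]
  simp only [C_sub, C_pow]
  ring

/-- The cofactor `y + y_P` takes the value `2 y_P ≠ 0` at `P`, so `x - x_P` divides `y - y_P`
locally. -/
theorem maximalIdeal_eq_span_x (P : Point h) (h2 : (2 : k) ≠ 0) (hy : P.y ≠ 0) :
    IsLocalRing.maximalIdeal (LocalRing P) =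
      Ideal.span {algebraMap _ (LocalRing P) (cls h (C (X - C P.x)))} := by
  rw [maximalIdeal_eq_span]
  apply le_antisymm
  · obtain ⟨g, -, hg⟩ := exists_curve_factorization P
    have hu : IsUnit (algebraMap (CoordRing h) (LocalRing P) (cls h (Y + C (C P.y)))) := by
      rw [isUnit_germ_iff]
      simpa [← two_mul] using And.intro h2 hy
    rw [Ideal.span_le]
    rintro _ (rfl | rfl)
    · exact Ideal.mem_span_singleton_self _
    · rw [SetLike.mem_coe, Ideal.mem_span_singleton, ← hu.dvd_mul_right, ← map_mul, ← map_mul, hg,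
        map_mul, map_mul]
      exact dvd_mul_right _ _
  · exact Ideal.span_mono (by simp)

/-- Now `y² = (x - x_P) g`, and `g(x_P) = 0` would make `x_P` a double root of `h`; so `g` is a unit
and `y` divides `x - x_P` locally. -/
theorem maximalIdeal_eq_span_y (P : Point h) (hy : P.y = 0) (hs : h.rootMultiplicity P.x ≤ 1)
    (h0 : h ≠ 0) :
    IsLocalRing.maximalIdeal (LocalRing P) =
      Ideal.span {algebraMap _ (LocalRing P) (cls h Y)} := by
  rw [maximalIdeal_eq_span]
  obtain ⟨g, hh, hg⟩ := exists_curve_factorization P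
  simp only [hy, map_zero, sub_zero, add_zero] at hg ⊢
  apply le_antisymm
  · have hu : IsUnit (algebraMap (CoordRing h) (LocalRing P) (cls h (C g))) := by
      rw [isUnit_germ_iff, eval_C]
      intro hr
      obtain ⟨t, rfl⟩ := dvd_iff_isRoot.mpr hr
      have : 2 ≤ h.rootMultiplicity P.x := by
        rw [le_rootMultiplicity_iff h0]
        exact ⟨t, by simpa [hy, sq, mul_assoc] using hh⟩
      omega
    rw [Ideal.span_le]
    rintro _ (rfl | rfl)
    · rw [SetLike.mem_coe, Ideal.mem_span_singleton, ← hu.dvd_mul_right, ← map_mul, ← map_mul, ← hg,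
        map_mul, map_mul]
      exact dvd_mul_right _ _
    · exact Ideal.mem_span_singleton_self _
  · exact Ideal.span_mono (by simp)

/-- Write the germ as `y * a`; a non-unit `a` would raise the order to at least two. -/
theorem maximalIdeal_le_span_of_ord_eq_one (P : Point h) (hy : P.y = 0)
    (hs : h.rootMultiplicity P.x ≤ 1) (h0 : h ≠ 0) {φ : CoordRing h} (hφ : ord P φ = 1) :
    IsLocalRing.maximalIdeal (LocalRing P) ≤ Ideal.span {algebraMap _ (LocalRing P) φ} := by
  have hm := maximalIdeal_eq_span_y P hy hs h0
  have h1 : algebraMap _ (LocalRing P) φ ∈ IsLocalRing.maximalIdeal (LocalRing P) := by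
    simpa using (le_ord_iff P φ 1).mp hφ.ge
  have h2 : algebraMap _ (LocalRing P) φ ∉ IsLocalRing.maximalIdeal (LocalRing P) ^ 2 := by
    rw [← le_ord_iff, hφ]
    norm_num
  rw [hm, Ideal.mem_span_singleton] at h1
  obtain ⟨a, ha⟩ := h1
  have hu : IsUnit a := by
    by_contra hcon
    have ha' : a ∈ IsLocalRing.maximalIdeal (LocalRing P) := hcon
    apply h2
    rw [ha, sq]
    exact Ideal.mul_mem_mul (by rw [hm]; exact Ideal.mem_span_singleton_self _) ha'
  rw [hm, Ideal.span_singleton_le_iff_mem, Ideal.mem_span_singleton, ha]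
  exact (hu.mul_right_dvd).mpr dvd_rfl

theorem isUnit_germ_of_ord_eq_zero {P : Point h} {φ : CoordRing h} (hφ : ord P φ = 0) :
    IsUnit (algebraMap _ (LocalRing P) φ) := by
  by_contra hcon
  have h1 : (1 : ℕ) ≤ ord P φ := (le_ord_iff P φ 1).mpr (by rw [pow_one]; exact hcon)
  rw [hφ] at h1
  exact absurd h1 (by norm_num)

theorem Point.eq_or_eq_invol {P Q : Point h} (hx : Q.x = P.x) : Q = P ∨ Q = P.invol := by
  have : Q.y ^ 2 = P.y ^ 2 := by rw [Q.eq, P.eq, hx]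
  rcases sq_eq_sq_iff_eq_or_eq_neg.mp this with hy | hy
  · exact Or.inl (Point.ext hx hy)
  · exact Or.inr (Point.ext hx hy)

theorem Point.invol_eq_self_iff (h2 : (2 : k) ≠ 0) (P : Point h) : P.invol = P ↔ P.y = 0 := by
  rw [Point.ext_iff]
  simp only [Point.invol, true_and, neg_eq_iff_add_eq_zero, ← two_mul, mul_eq_zero, h2, false_or]

end DoubleCover

/-! ### Divisors and their ideals -/

namespace HyperellipticCurve

open DoubleCover

variable {K : Type*} [Field K] {𝒞 : HyperellipticCurve K}

theorem two_ne_zero_algebraicClosure (𝒞 : HyperellipticCurve K) : (2 : AlgebraicClosure K) ≠ 0 := by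
  have h2 := Ring.two_ne_zero 𝒞.char_ne_two
  rw [← map_ofNat (algebraMap K (AlgebraicClosure K)) 2]
  exact (_root_.map_ne_zero _).mpr h2

theorem fbar_ne_zero (𝒞 : HyperellipticCurve K) : 𝒞.fbar ≠ 0 := (𝒞.monic.map _).ne_zero

theorem rootMultiplicity_fbar_le_one (𝒞 : HyperellipticCurve K) (x : AlgebraicClosure K) :
    𝒞.fbar.rootMultiplicity x ≤ 1 := by
  classical
  rw [← count_roots]
  exact Multiset.nodup_iff_count_le_one.mp 𝒞.nodup_roots x

theorem pullback_nonneg {D : 𝒞.Divisor} (hD : ∀ P, 0 ≤ D P) (P : 𝒞.Point) :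
    0 ≤ pullback D P := by
  classical
  rw [pullback, Finsupp.mapDomain, Finsupp.sum_apply]
  refine Finset.sum_nonneg fun Q _ => ?_
  simp only [Finsupp.single_apply]
  split_ifs
  exacts [hD Q, le_rfl]

/-- Only `P` and its conjugate lie over `x_P`. -/
theorem eval_xPoly_ne_zero {D : 𝒞.Divisor} {P : 𝒞.AffPoint} (h1 : D (some P) = 0)
    (h2 : D (some P.invol) = 0) : (xPoly D).eval P.x ≠ 0 := by
  rw [xPoly, Finsupp.prod, eval_prod, Finset.prod_ne_zero_iff]
  rintro (_ | Q) hQ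
  · simp
  · simp only [Option.elim, eval_pow, eval_sub, eval_X, eval_C]
    refine pow_ne_zero _ (sub_ne_zero.mpr fun hx => ?_)
    rw [Finsupp.mem_support_iff] at hQ
    rcases Point.eq_or_eq_invol hx.symm with rfl | rfl
    · exact hQ h1
    · exact hQ h2

theorem xPoly_eq_mul_erase {D : 𝒞.Divisor} {P : 𝒞.AffPoint} (hP : some P ∈ D.support) :
    xPoly D = (X - C P.x) ^ (D (some P)).toNat * xPoly (D.erase (some P)) :=
  (Finsupp.mul_prod_erase D _ _ hP).symm

theorem map_idealOf_le (D : 𝒞.Divisor) {P : 𝒞.AffPoint} (hP : some P ∈ D.support) :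
    (idealOf D).map (algebraMap _ (LocalRing P)) ≤
      IsLocalRing.maximalIdeal (LocalRing P) ^ (D (some P)).toNat := by
  rw [Ideal.map_le_iff_le_comap]
  intro φ hφ
  exact (le_ord_iff P φ _).mp (hφ P hP)

theorem cls_xPoly_mem_idealOf (D : 𝒞.Divisor) : 𝒞.cls (C (xPoly D)) ∈ idealOf D := by
  intro P hP
  rw [le_ord_iff, xPoly_eq_mul_erase hP]
  simp only [map_mul, map_pow]
  refine Ideal.mul_mem_right _ _ (Ideal.pow_mem_pow ?_ _)
  rw [maximalIdeal_eq_span]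
  exact Ideal.subset_span (by simp)

/-- The conjugate of `P` is not in the support, so the factors of `xPoly D` from other points are
units at `P`. -/
theorem IsSemiReduced.map_idealOf_le_span_xPoly {D : 𝒞.Divisor} (hD : IsSemiReduced D)
    {P : 𝒞.AffPoint} (hP : some P ∈ D.support) (hy : P.y ≠ 0) :
    (idealOf D).map (algebraMap _ (LocalRing P)) ≤
      Ideal.span {algebraMap _ (LocalRing P) (𝒞.cls (C (xPoly D)))} := by
  have hne : P.invol ≠ P := (Point.invol_eq_self_iff 𝒞.two_ne_zero_algebraicClosure P).not.mpr hy
  have hpos : 0 < D (some P) :=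
    lt_of_le_of_ne (hD.effective _) (Finsupp.mem_support_iff.mp hP).symm
  have h0 : D (some P.invol) = 0 :=
    hD.not_fixed (some P) (fun hc => hne (Option.some_injective _ hc)) hpos
  refine (map_idealOf_le D hP).trans ?_
  rw [maximalIdeal_eq_span_x P 𝒞.two_ne_zero_algebraicClosure hy, Ideal.span_singleton_pow,
    Ideal.span_singleton_le_iff_mem, Ideal.mem_span_singleton, xPoly_eq_mul_erase hP]
  have hu : IsUnit (algebraMap 𝒞.CoordRing (LocalRing P)
      (𝒞.cls (C (xPoly (D.erase (some P)))))) := by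
    rw [isUnit_germ_iff, eval_C]
    apply eval_xPoly_ne_zero
    · exact Finsupp.erase_same
    · rw [Finsupp.erase_ne (fun hc => hne (Option.some_injective _ hc)), h0]
  simp only [map_mul C, map_pow C, map_mul (cls _), map_pow (cls _), map_mul (algebraMap _ _),
    map_pow (algebraMap _ _)]
  exact hu.mul_right_dvd.mpr dvd_rfl

/-- The local comparison, for any effective `E` in place of `ι^* r`; only the affine orders of `φ`
enter. -/
theorem idealOf_eq_span {D E : 𝒞.Divisor} (hD : IsSemiReduced D) (hE : ∀ P, 0 ≤ E P)
    (hDE : IsSemiReduced (D + E)) {φ : 𝒞.CoordRing}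
    (hφ : ∀ P : 𝒞.AffPoint, ∃ n : ℕ, ord P φ = n ∧ (D + E) (some P) = n) :
    idealOf D = Ideal.span {𝒞.cls (C (xPoly D)), φ} := by
  apply le_antisymm
  · refine le_of_forall_point fun P => ?_
    rw [Ideal.map_span, Set.image_pair]
    obtain ⟨n, hn, hn'⟩ := hφ P
    have hu := Ideal.span_mono (α := LocalRing P) (Set.subset_insert
      (algebraMap _ (LocalRing P) (𝒞.cls (C (xPoly D)))) {algebraMap _ (LocalRing P) φ})
    by_cases hP : some P ∈ D.support
    · by_cases hy : P.y = 0
      · refine (map_idealOf_le D hP).trans ?_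
        have hfix : 𝒞.ι (some P) = some P := congrArg some
          ((Point.invol_eq_self_iff 𝒞.two_ne_zero_algebraicClosure P).mpr hy)
        have h1 := hDE.fixed _ hfix
        have h2 := hD.effective (some P)
        have h3 := Finsupp.mem_support_iff.mp hP
        have h4 := hE (some P)
        rw [Finsupp.add_apply] at h1 hn'
        -- `D` is already at least `1` at the fixed point `P`, while `D + E` is at most `1`.
        obtain rfl : n = 1 := by omega
        have h5 : (D (some P)).toNat = 1 := by omega
        rw [h5, pow_one]
        exact (maximalIdeal_le_span_of_ord_eq_one P hy (𝒞.rootMultiplicity_fbar_le_one _)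
          𝒞.fbar_ne_zero hn).trans hu
      · exact (hD.map_idealOf_le_span_xPoly hP hy).trans (Ideal.span_mono (by simp))
    · have h0 : D (some P) = 0 := by simpa using hP
      by_cases hQ : D (some P.invol) = 0
      · have hv : IsUnit (algebraMap _ (LocalRing P) (𝒞.cls (C (xPoly D)))) := by
          rw [isUnit_germ_iff, eval_C]
          exact eval_xPoly_ne_zero h0 hQ
        rw [← Ideal.span_singleton_eq_top] at hv
        exact le_top.trans (hv.ge.trans (Ideal.span_mono (by simp)))
      · have hinv : 𝒞.ι (some P.invol) = some P := by
          simp [ι, Point.invol]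
        have hne : 𝒞.ι (some P.invol) ≠ some P.invol := by
          rw [hinv]
          intro hc
          rw [← hc] at hQ
          exact hQ h0
        -- `D + E` is positive at the conjugate of `P`, hence zero at `P`.
        have h1 : (D + E) (some P) = 0 := by
          rw [← hinv]
          refine hDE.not_fixed _ hne ?_
          have h2 := hD.effective (some P.invol)
          have h3 := hE (some P.invol)
          rw [Finsupp.add_apply]
          omega
        have hn0 : n = 0 := by omega
        subst hn0
        have hv : IsUnit (algebraMap _ (LocalRing P) φ) :=
          isUnit_germ_of_ord_eq_zero (by simpa using hn)
        rw [← Ideal.span_singleton_eq_top] at hv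
        rw [hv] at hu
        exact le_top.trans hu
  · rw [Ideal.span_le]
    rintro _ (rfl | rfl)
    · exact cls_xPoly_mem_idealOf D
    · intro P hP
      obtain ⟨n, hn, hn'⟩ := hφ P
      rw [hn]
      have h3 := hE (some P)
      rw [Finsupp.add_apply] at hn'
      exact_mod_cast (by omega : (D (some P)).toNat ≤ n)

end HyperellipticCurve

theorem mainTheorem2 {K : Type*} [Field K] (𝒞 : HyperellipticCurve K) (d r : 𝒞.Divisor)
    (hd : HyperellipticCurve.IsSemiReduced d)
    (hr : HyperellipticCurve.IsReductionOf r d)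
    (hclub : HyperellipticCurve.IsSemiReduced (d + HyperellipticCurve.pullback r))
    (u v : (AlgebraicClosure K)[X]) (huv : HyperellipticCurve.IsMumfordRep d u v)
    (b₀ b₁ : (AlgebraicClosure K)[X])
    (hb : HyperellipticCurve.IsLeitenbergerFunction d r b₀ b₁) :
    HyperellipticCurve.polyIdealOf d =
        Ideal.span {C u, C b₀ + C b₁ * Y, Y ^ 2 - C 𝒞.fbar} ∧
      HyperellipticCurve.idealOf d =
        Ideal.span {𝒞.cls (C u), 𝒞.cls (C b₀ + C b₁ * Y)} := by
  have key : HyperellipticCurve.idealOf d =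
      Ideal.span {𝒞.cls (C u), 𝒞.cls (C b₀ + C b₁ * Y)} := by
    rw [huv.u_eq]
    refine HyperellipticCurve.idealOf_eq_span hd
      (HyperellipticCurve.pullback_nonneg hr.semiReduced.effective) hclub fun P => ?_
    obtain ⟨n, hn, hn'⟩ := hb.1 P
    refine ⟨n, hn, ?_⟩
    -- The multiple of `O` does not contribute at affine points.
    simpa [HyperellipticCurve.multO] using hn'
  refine ⟨?_, key⟩
  -- Pulling an extended ideal back along the surjection `cls` adds exactly its kernel.
  have hker : Ideal.comap 𝒞.cls ⊥ = Ideal.span {Y ^ 2 - C 𝒞.fbar} := Ideal.mk_ker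
  rw [HyperellipticCurve.polyIdealOf, key, ← Set.image_pair, ← Ideal.map_span,
    Ideal.comap_map_of_surjective _ AdjoinRoot.mk_surjective, hker, ← Ideal.span_union]
  congr 1
  ext q
  simp only [Set.mem_union, Set.mem_insert_iff, Set.mem_singleton_iff, or_assoc]
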